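/- Let $Q_{n,2}$ be the $(n,2)$-enhanced hypercube: its vertices are the binary strings $x_nx_{n-1}\cdots x_1$, and two of them are adjacent iff they differ in exactly one bit or they differ exactly in the bits $x_{n-1},\dots,x_1$. For a finite connected graph $G$ let $\lambda_h(G)$ be the minimum cardinality of a set of edges whose deletion leaves a disconnected graph all of whose components have at least $h$ vertices, and let $\xi_m(G)$ be the minimum number of edges between $X$ and $V(G)\setminus X$ over all $X\subseteq V(G)$ with $|X|=m\le\lfloor |V(G)|/2\rfloor$ such that $G[X]$ and $G[V(G)\setminus X]$ are both connected. $G$ is called $\lambda_h$-optimal if $\lambda_h(G)=\xi_h(G)$. Put $f=0$ if $n$ is even, $f=1$ if $n$ is odd, and for $1\le r\le\lceil n/2\rceil-1$ $$m_{n,r}=\begin{cases}\sum_{i=0}^{2}2^{n-4-i}+\sum_{i=0}^{\lceil n/2\rceil-4-r}2^{n-8-2i}+2^{2r-1-f}&\text{if }1\le r\le\lceil n/2\rceil-4,\\ \sum_{i=0}^{3}2^{n-4-i}&\text{if }r=\lceil n/2\rceil-3,\\ 2^{n-3}&\text{if }r=\lceil n/2\rceil-2,\\ 2^{n-1}&\text{if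 }r=\lceil n/2\rceil-1.\end{cases}$$ **Theorem 1.** Let $n\ge 9$. (a) For every integer $h$ with $\lceil 11\cdot 2^{n-1}/48\rceil\le h\le 2^{n-1}$ we have $\lambda_h(Q_{n,2})=\xi_{2^{n-1}}(Q_{n,2})=2^{n-1}$. (b) For every such $h$, the graph $Q_{n,2}$ is $\lambda_h$-optimal, with $\lambda_h(Q_{n,2})=\xi_h(Q_{n,2})=2^{n-1}$, if and only if $h=m_{n,r}$ for some $1\le r\le\lceil n/2\rceil-1$. Moreover $\lceil 11\cdot 2^{n-1}/48\rceil=m_{n,1}<m_{n,2}<\dots<m_{n,\lceil n/2\rceil-1}=2^{n-1}$, so that the $m_{n,r}$ split the interval into $\lceil n/2\rceil-2$ subintervals, and $\xi_m(Q_{n,2})>2^{n-1}$ for every integer $m$ with $m_{n,r}<m<m_{n,r+1}$, $1\le r\le\lceil n/2\rceil-2$. -/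

import Mathlib

/-- The `(n, k)`-enhanced hypercube `Q_{n,k}` (for `1 ≤ k ≤ n - 1`): the vertices are the binary
strings `x_n ⋯ x_1`, the bit `x_{j+1}` being stored at the index `j : Fin n`. Two distinct strings
are adjacent if they differ in exactly one bit, or if one arises from the other by complementing
precisely the bits `x_1, …, x_{n-k+1}` (a `k`-complementary edge). -/
def enhancedHypercube (n k : ℕ) : SimpleGraph (Fin n → Bool) where
  Adj x y := x ≠ y ∧
    ((∃ i : Fin n, y = Function.update x i (!(x i))) ∨
      y = fun j : Fin n => if (j : ℕ) + 1 ≤ n - k + 1 then !(x j) else x j)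
  symm := by
    constructor
    rintro x y ⟨hne, h⟩
    refine ⟨hne.symm, ?_⟩
    rcases h with ⟨i, rfl⟩ | rfl
    · exact Or.inl ⟨i, by simp⟩
    · refine Or.inr (funext fun j => ?_)
      by_cases hj : (j : ℕ) + 1 ≤ n - k + 1 <;> simp [hj]
  loopless := ⟨fun _ h => h.1 rfl⟩

/-- `F` is an `h`-extra edge-cut of `G`: a set of edges of `G` whose deletion leaves a disconnected
graph all of whose components have at least `h` vertices. -/
def IsExtraEdgeCut {V : Type*} [Finite V] (G : SimpleGraph V) (h : ℕ) (F : Finset (Sym2 V)) :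
    Prop :=
  (F : Set (Sym2 V)) ⊆ G.edgeSet ∧ ¬ (G.deleteEdges (F : Set (Sym2 V))).Connected ∧
    ∀ c : (G.deleteEdges (F : Set (Sym2 V))).ConnectedComponent, h ≤ c.supp.ncard

/-- The `h`-extra edge-connectivity `λ_h(G)`: the minimum cardinality of an `h`-extra edge-cut
(with the value `0` if there is none). -/
noncomputable def extraEdgeConnectivity {V : Type*} [Finite V] (G : SimpleGraph V) (h : ℕ) : ℕ :=
  sInf {c : ℕ | ∃ F : Finset (Sym2 V), IsExtraEdgeCut G h F ∧ F.card = c}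

/-- The set `[X, Xᶜ]_G` of the edges of `G` with one end in `X` and the other end outside `X`. -/
def edgeBoundary {V : Type*} (G : SimpleGraph V) (X : Set V) : Set (Sym2 V) :=
  {e | e ∈ G.edgeSet ∧ ∃ u ∈ X, ∃ v ∉ X, e = s(u, v)}

/-- `ξ_m(G)`: the minimum of `|[X, Xᶜ]_G|` over the vertex sets `X` with
`|X| = m ≤ ⌊|V(G)| / 2⌋` for which both `G[X]` and `G[Xᶜ]` are connected
(with the value `0` if there is none). -/
noncomputable def minEdgeBoundary {V : Type*} [Finite V] (G : SimpleGraph V) (m : ℕ) : ℕ :=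
  sInf {c : ℕ | ∃ X : Set V, X.ncard = m ∧ m ≤ Nat.card V / 2 ∧
    (G.induce X).Connected ∧ (G.induce Xᶜ).Connected ∧ (edgeBoundary G X).ncard = c}

/-- `G` is `λ_h`-optimal if `λ_h(G) = ξ_h(G)`. -/
def IsExtraOptimal {V : Type*} [Finite V] (G : SimpleGraph V) (h : ℕ) : Prop :=
  extraEdgeConnectivity G h = minEdgeBoundary G h

/-- The breakpoints `m_{n,r}` for `1 ≤ r ≤ ⌈n/2⌉ - 1` and `n ≥ 9`; here `n % 2` is `0` for even `n`
and `1` for odd `n`. No subtraction is truncated in this range. The value outside the range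
of `r` is irrelevant. -/
def breakpoint (n r : ℕ) : ℕ :=
  if r + 4 ≤ n ⌈/⌉ 2 then
    ∑ i ∈ Finset.Icc 0 2, 2 ^ (n - 4 - i)
      + ∑ i ∈ Finset.Icc 0 (n ⌈/⌉ 2 - 4 - r), 2 ^ (n - 8 - 2 * i)
      + 2 ^ (2 * r - 1 - n % 2)
  else if r + 3 = n ⌈/⌉ 2 then ∑ i ∈ Finset.Icc 0 3, 2 ^ (n - 4 - i)
  else if r + 2 = n ⌈/⌉ 2 then 2 ^ (n - 3)
  else if r + 1 = n ⌈/⌉ 2 then 2 ^ (n - 1)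
  else 0

/-!
`Q_{n,2}` is the Cartesian product of the folded hypercube of dimension `d = n - 1` with an edge.
The heart of the matter is an edge-isoperimetric inequality for the folded hypercube: a set of at
most half of its vertices encloses no more edges than the best set of the same size in the
hypercube, whose number of edges is `cubeEdges` (`cubeDegreeSum_add_antipodalCount_le`). It is
proved by induction on the dimension. Cutting along a bit leaves two parts `P` and `R` of an
ordinary cube, joined by the edges in the direction of that bit and by complementary edges. The
surplus of these edges over `#R` is paid for by the complementary edges inside `P` and inside `R`
(`two_mul_card_inter_add_le`), which the induction hypothesis controls, and the superadditivity
`cubeEdges_add_le` finishes the step.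

Consequently a set of `m ≤ 2 ^ (n - 1)` vertices of `Q_{n,2}` has at least
`(n + 1) m - 2 e(m)` boundary edges, where `e = cubeEdges`, or else more than `2 ^ (n - 1)`, or it
is one of the two copies of the folded hypercube (`le_ncard_edgeBoundary`). Above `2 ^ (n - 3)` the
function `(n + 1) m - 2 e(m)` exceeds `2 ^ (n - 1)`. For `m = 2 ^ (n - 3) - c`, passing to the
complement inside a cube of dimension `n - 3` turns it into `2 ^ (n - 1) + (k c - 2 e(c))` with
`k = n - 7`. For `c ≤ 4 * 2 ^ k / 3`, which is the range of the theorem, `k c - 2 e(c)` is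
nonnegative, and it vanishes exactly at the sums `2 ^ k + 2 ^ (k - 2) + ⋯`, because beyond `2 ^ k`
it reproduces itself with `k - 2` in place of `k` (`two_mul_cubeEdges_le_of_three_mul_le`). These
zeros are the breakpoints (`breakpoint_add_evenGapSum`).

Initial segments of the binary order are connected with connected complement and attain the bound,
and so determine `ξ_m` at the breakpoints. For `λ_h`, every extra edge-cut contains the boundary of
a component with at most half of the vertices, while the boundary of a copy of the folded hypercube
is an extra edge-cut of size `2 ^ (n - 1)`.
-/

/-! ### The extremal function of the hypercube -/

/-- The number of edges of the subgraph of a hypercube induced by the first `m` vertices in the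
binary order. It is the largest number of edges on `m` vertices of a hypercube, and is given by
cutting the `m` vertices into two halves that are as equal as possible. -/
def cubeEdges (m : ℕ) : ℕ :=
  if m < 2 then 0 else cubeEdges (m / 2) + cubeEdges ((m + 1) / 2) + m / 2
termination_by m
decreasing_by all_goals omega

@[simp] theorem cubeEdges_zero : cubeEdges 0 = 0 := by rw [cubeEdges]; simp

@[simp] theorem cubeEdges_one : cubeEdges 1 = 0 := by rw [cubeEdges]; simp

theorem cubeEdges_two_mul (m : ℕ) : cubeEdges (2 * m) = 2 * cubeEdges m + m := by
  rcases Nat.eq_zero_or_pos m with rfl | hm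
  · simp
  · rw [cubeEdges, if_neg (by omega), show 2 * m / 2 = m by omega,
      show (2 * m + 1) / 2 = m by omega]
    ring

theorem cubeEdges_two_mul_add_one (m : ℕ) :
    cubeEdges (2 * m + 1) = cubeEdges m + cubeEdges (m + 1) + m := by
  rcases Nat.eq_zero_or_pos m with rfl | hm
  · simp
  · rw [cubeEdges, if_neg (by omega), show (2 * m + 1) / 2 = m by omega,
      show (2 * m + 1 + 1) / 2 = m + 1 by omega]

/-- The superadditivity behind the edge-isoperimetric inequality of the hypercube. -/
theorem cubeEdges_add_le (a b : ℕ) :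
    cubeEdges a + cubeEdges b + min a b ≤ cubeEdges (a + b) := by
  induction hs : a + b using Nat.strong_induction_on generalizing a b with
  | _ s ih =>
    subst hs
    rcases Nat.eq_zero_or_pos a with rfl | ha
    · simp
    rcases Nat.eq_zero_or_pos b with rfl | hb
    · simp
    by_cases hab : a = 1 ∧ b = 1
    · obtain ⟨rfl, rfl⟩ := hab
      have := cubeEdges_two_mul 1
      simp at this ⊢
      omega
    obtain ⟨a', rfl | rfl⟩ := Nat.even_or_odd' a <;>
    obtain ⟨b', rfl | rfl⟩ := Nat.even_or_odd' b
    · have := ih (a' + b') (by omega) a' b' rfl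
      rw [← mul_add, cubeEdges_two_mul, cubeEdges_two_mul, cubeEdges_two_mul]
      omega
    · have h1 := ih (a' + b') (by omega) a' b' rfl
      have h2 := ih (a' + (b' + 1)) (by omega) a' (b' + 1) rfl
      rw [← add_assoc, ← mul_add, cubeEdges_two_mul, cubeEdges_two_mul_add_one,
        cubeEdges_two_mul_add_one]
      rw [← add_assoc] at h2
      omega
    · have h1 := ih (a' + b') (by omega) a' b' rfl
      have h2 := ih (a' + 1 + b') (by omega) (a' + 1) b' rfl
      rw [show 2 * a' + 1 + 2 * b' = 2 * (a' + b') + 1 by ring, cubeEdges_two_mul,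
        cubeEdges_two_mul_add_one, cubeEdges_two_mul_add_one]
      rw [add_right_comm a' 1 b'] at h2
      omega
    · have h1 := ih (a' + 1 + b') (by omega) (a' + 1) b' rfl
      have h2 := ih (a' + (b' + 1)) (by omega) a' (b' + 1) rfl
      rw [show 2 * a' + 1 + (2 * b' + 1) = 2 * (a' + b' + 1) by ring, cubeEdges_two_mul,
        cubeEdges_two_mul_add_one, cubeEdges_two_mul_add_one]
      rw [add_right_comm a' 1 b'] at h1
      rw [← add_assoc] at h2
      omega

theorem two_mul_cubeEdges_two_pow (k : ℕ) : 2 * cubeEdges (2 ^ k) = k * 2 ^ k := by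
  induction k with
  | zero => simp
  | succ k ih =>
    rw [pow_succ', cubeEdges_two_mul]
    linear_combination 2 * ih

theorem cubeEdges_two_pow_add (k t : ℕ) (ht : t ≤ 2 ^ k) :
    cubeEdges (2 ^ k + t) = cubeEdges (2 ^ k) + cubeEdges t + t := by
  induction k generalizing t with
  | zero =>
    have h := cubeEdges_two_mul 1
    have ht : t = 0 ∨ t = 1 := by simp at ht; omega
    rcases ht with rfl | rfl <;> simp_all
  | succ k ih =>
    rw [pow_succ'] at ht ⊢
    obtain ⟨t', rfl | rfl⟩ := Nat.even_or_odd' t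
    · have := ih t' (by omega)
      rw [← mul_add, cubeEdges_two_mul, cubeEdges_two_mul, cubeEdges_two_mul]
      omega
    · have h1 := ih t' (by omega)
      have h2 := ih (t' + 1) (by omega)
      rw [← add_assoc, ← mul_add, cubeEdges_two_mul_add_one, cubeEdges_two_mul_add_one,
        cubeEdges_two_mul]
      rw [← add_assoc] at h2
      omega

/-- `m ≤ 2 ^ k` vertices of a hypercube have average degree at most `k`, with equality only for
the empty set and for subcubes of dimension `k`. -/
theorem two_mul_cubeEdges_le (k m : ℕ) (hm : m ≤ 2 ^ k) :
    2 * cubeEdges m ≤ k * m ∧ (2 * cubeEdges m = k * m → m = 0 ∨ m = 2 ^ k) := by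
  induction k generalizing m with
  | zero =>
    have hm : m = 0 ∨ m = 1 := by simp at hm; omega
    rcases hm with rfl | rfl <;> simp
  | succ k ih =>
    rcases le_or_gt m (2 ^ k) with h | h
    · have := (ih m h).1
      rw [add_one_mul]
      omega
    · obtain ⟨t, rfl⟩ := Nat.exists_eq_add_of_lt h
      rw [pow_succ'] at hm ⊢
      have h1 := cubeEdges_two_pow_add k (t + 1) (by omega)
      have h2 := (ih (t + 1) (by omega)).1
      have h3 := two_mul_cubeEdges_two_pow k
      have h4 : (k + 1) * (2 ^ k + (t + 1))
          = k * 2 ^ k + k * (t + 1) + (2 ^ k + (t + 1)) := by ring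
      rw [add_assoc, h1, h4]
      omega

/-- The extremal function is compatible with complementation inside a `k`-dimensional cube: the
first `2 ^ k - c` vertices and the last `c` vertices have the same edge boundary. -/
theorem two_mul_cubeEdges_of_add_eq_two_pow (k m c : ℕ) (h : m + c = 2 ^ k) :
    2 * cubeEdges m + k * c = k * m + 2 * cubeEdges c := by
  induction k generalizing m c with
  | zero =>
    have : (m = 0 ∧ c = 1) ∨ (m = 1 ∧ c = 0) := by simp at h; omega
    rcases this with ⟨rfl, rfl⟩ | ⟨rfl, rfl⟩ <;> simp
  | succ k ih =>
    wlog hc : c ≤ 2 ^ k generalizing m c with H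
    · have := H c m (by omega) (by rw [pow_succ'] at h; omega)
      omega
    rw [pow_succ'] at h
    obtain ⟨t, rfl⟩ : ∃ t, m = 2 ^ k + t := Nat.exists_eq_add_of_le (by omega)
    have h1 := cubeEdges_two_pow_add k t (by omega)
    have h2 := ih t c (by omega)
    have h3 := two_mul_cubeEdges_two_pow k
    rw [h1]
    have : 2 ^ k = t + c := by omega
    rw [this] at h3 ⊢
    linarith

/-! ### The breakpoints as zeros of an arithmetic function -/

/-- The partial sums `2 ^ k + 2 ^ (k - 2) + 2 ^ (k - 4) + ⋯` with `s` terms. They are the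
deviations of the breakpoints from `2 ^ (n - 3)`, where `k = n - 7`. -/
def evenGapSum (k s : ℕ) : ℕ := ∑ j ∈ Finset.range s, 2 ^ (k - 2 * j)

theorem evenGapSum_succ (k s : ℕ) : evenGapSum k (s + 1) = evenGapSum k s + 2 ^ (k - 2 * s) :=
  Finset.sum_range_succ _ _

theorem evenGapSum_add_two_succ (k s : ℕ) :
    evenGapSum (k + 2) (s + 1) = 2 ^ (k + 2) + evenGapSum k s := by
  rw [evenGapSum, Finset.sum_range_succ', add_comm, evenGapSum]
  congr 1
  refine Finset.sum_congr rfl fun j _ => ?_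
  congr 1
  omega

theorem three_mul_evenGapSum (k s : ℕ) (hs : 2 * s ≤ k + 2) :
    3 * evenGapSum k s + 2 ^ (k + 2 - 2 * s) = 4 * 2 ^ k := by
  induction s with
  | zero => simp [evenGapSum, pow_add]; ring
  | succ s ih =>
    have := ih (by omega)
    rw [evenGapSum_succ, show k + 2 - 2 * (s + 1) = k - 2 * s by omega]
    rw [show k + 2 - 2 * s = (k - 2 * s) + 2 by omega, pow_add] at this
    omega

/-- Up to four thirds of `2 ^ k`, the average degree of the first `c` vertices of a hypercube does
not exceed `k`, and the values of `c` where it equals `k` are the sums `evenGapSum k s`: beyond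
`2 ^ k` the problem repeats itself with `k - 2` in place of `k`. -/
theorem two_mul_cubeEdges_le_of_three_mul_le (k c : ℕ) (hc : 3 * c ≤ 4 * 2 ^ k) :
    2 * cubeEdges c ≤ k * c ∧
      (2 * cubeEdges c = k * c ↔ ∃ s, 2 * s ≤ k + 2 ∧ c = evenGapSum k s) := by
  have two_pow_case : ∀ k, 2 * cubeEdges (2 ^ k) ≤ k * 2 ^ k ∧
      (2 * cubeEdges (2 ^ k) = k * 2 ^ k ↔ ∃ s, 2 * s ≤ k + 2 ∧ 2 ^ k = evenGapSum k s) :=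
    fun k => ⟨(two_mul_cubeEdges_two_pow k).le, fun _ => ⟨1, by omega, by simp [evenGapSum]⟩,
      fun _ => two_mul_cubeEdges_two_pow k⟩
  induction k using Nat.strong_induction_on generalizing c with
  | _ k ih =>
    rcases lt_trichotomy c (2 ^ k) with h | rfl | h
    · obtain ⟨h1, h2⟩ := two_mul_cubeEdges_le k c h.le
      refine ⟨h1, fun he => ⟨0, by omega, ?_⟩, ?_⟩
      · rcases h2 he with h0 | h0
        · simpa [evenGapSum] using h0
        · omega
      · rintro ⟨s, hs, rfl⟩
        rcases s with _ | s
        · simp [evenGapSum]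
        · exfalso
          have : 2 ^ k ≤ evenGapSum k (s + 1) := by
            rw [evenGapSum, Finset.sum_range_succ']
            simp
          omega
    · exact two_pow_case k
    · obtain _ | _ | k := k
      · simp at hc h; omega
      · simp at hc h; omega
      · obtain ⟨t, rfl⟩ := Nat.exists_eq_add_of_lt h
        rw [add_assoc]
        rw [show k + 1 + 1 = k + 2 from rfl] at *
        have hk : 2 ^ (k + 2) = 4 * 2 ^ k := by rw [pow_add]; ring
        obtain ⟨h1, h2⟩ := ih k (by omega) (t + 1) (by omega)
        have h3 := cubeEdges_two_pow_add (k + 2) (t + 1) (by omega)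
        have h4 := two_mul_cubeEdges_two_pow (k + 2)
        have h5 : (k + 2) * (2 ^ (k + 2) + (t + 1))
            = (k + 2) * 2 ^ (k + 2) + k * (t + 1) + 2 * (t + 1) := by ring
        refine ⟨by omega, ?_⟩
        have h6 : 2 * cubeEdges (2 ^ (k + 2) + (t + 1)) = (k + 2) * (2 ^ (k + 2) + (t + 1)) ↔
            2 * cubeEdges (t + 1) = k * (t + 1) := by omega
        rw [h6, h2]
        constructor
        · rintro ⟨s, hs, he⟩
          exact ⟨s + 1, by omega, by rw [evenGapSum_add_two_succ, he]⟩
        · rintro ⟨s, hs, he⟩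
          rcases s with _ | s
          · simp [evenGapSum] at he
          · exact ⟨s, by omega, by rw [evenGapSum_add_two_succ] at he; omega⟩

theorem ceilDiv_two (n : ℕ) : n ⌈/⌉ 2 = (n + 1) / 2 := by
  rw [Nat.ceilDiv_eq_add_pred_div]
  omega

theorem breakpoint_last (n : ℕ) (hn : 9 ≤ n) : breakpoint n (n ⌈/⌉ 2 - 1) = 2 ^ (n - 1) := by
  have := ceilDiv_two n
  rw [breakpoint, if_neg (by omega), if_neg (by omega), if_neg (by omega), if_pos (by omega)]

/-- Every breakpoint but the last is `2 ^ (n - 3)` minus a sum `evenGapSum (n - 7) s`. -/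
theorem breakpoint_add_evenGapSum (n s : ℕ) (hn : 9 ≤ n) (hs : s + 3 ≤ n ⌈/⌉ 2) :
    breakpoint n (n ⌈/⌉ 2 - 2 - s) + evenGapSum (n - 7) s = 2 ^ (n - 3) := by
  have hc := ceilDiv_two n
  obtain ⟨d, rfl⟩ : ∃ d, n = d + 9 := ⟨n - 9, by omega⟩
  rcases s with _ | _ | s
  · rw [breakpoint, if_neg (by omega), if_neg (by omega), if_pos (by omega)]
    simp [evenGapSum]
  · rw [breakpoint, if_neg (by omega), if_pos (by omega)]
    simp [evenGapSum, Finset.sum_Icc_succ_top, pow_add]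
    ring
  · rw [breakpoint, if_pos (by omega),
      show (d + 9) ⌈/⌉ 2 - 4 - ((d + 9) ⌈/⌉ 2 - 2 - (s + 1 + 1)) = s by omega,
      show 2 * ((d + 9) ⌈/⌉ 2 - 2 - (s + 1 + 1)) - 1 - (d + 9) % 2 = d - 2 * s by omega]
    have hsd : 2 * s ≤ d := by omega
    have key : ∀ s, 2 * s ≤ d → ∑ i ∈ Finset.Icc 0 s, 2 ^ (d + 9 - 8 - 2 * i) + 2 ^ (d - 2 * s)
        + evenGapSum (d + 2) (s + 2) = 8 * 2 ^ d := by
      intro s hs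
      induction s with
      | zero => simp [evenGapSum, Finset.sum_range_succ, pow_add]; ring
      | succ s ih =>
        have := ih (by omega)
        rw [Finset.sum_Icc_succ_top (by omega), show s + 1 + 2 = (s + 2) + 1 by ring,
          evenGapSum_succ]
        obtain ⟨u, rfl⟩ : ∃ u, d = u + 2 * (s + 1) := ⟨d - 2 * (s + 1), by omega⟩
        rw [show u + 2 * (s + 1) - 2 * s = u + 2 by omega] at this
        rw [show u + 2 * (s + 1) + 9 - 8 - 2 * (s + 1) = u + 1 by omega,
          show u + 2 * (s + 1) - 2 * (s + 1) = u by omega,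
          show u + 2 * (s + 1) + 2 - 2 * (s + 2) = u by omega]
        have e1 : 2 ^ (u + 2) = 4 * 2 ^ u := by rw [pow_add]; ring
        have e2 : 2 ^ (u + 1) = 2 * 2 ^ u := by rw [pow_add]; ring
        omega
    have := key s hsd
    have h3 : ∑ i ∈ Finset.Icc 0 2, 2 ^ (d + 9 - 4 - i) = 56 * 2 ^ d := by
      simp [Finset.sum_Icc_succ_top, pow_add]; ring
    have h4 : 2 ^ (d + 9 - 3) = 64 * 2 ^ d := by
      simp [pow_add]; ring
    rw [show d + 9 - 7 = d + 2 by omega, show s + 1 + 1 = s + 2 from rfl, h3, h4]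
    omega

theorem breakpoint_lt_succ (n r : ℕ) (hn : 9 ≤ n) (hr : 1 ≤ r) (hr' : r < n ⌈/⌉ 2 - 1) :
    breakpoint n r < breakpoint n (r + 1) := by
  have hc := ceilDiv_two n
  obtain ⟨s, hs⟩ : ∃ s, r = n ⌈/⌉ 2 - 2 - s := ⟨n ⌈/⌉ 2 - 2 - r, by omega⟩
  rcases s with _ | s
  · have h1 := breakpoint_add_evenGapSum n 0 hn (by omega)
    rw [← hs] at h1
    rw [show r + 1 = n ⌈/⌉ 2 - 1 by omega, breakpoint_last n hn]
    have : 2 ^ (n - 3) < 2 ^ (n - 1) := Nat.pow_lt_pow_right (by omega) (by omega)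
    omega
  · have h1 := breakpoint_add_evenGapSum n (s + 1) hn (by omega)
    have h2 := breakpoint_add_evenGapSum n s hn (by omega)
    rw [evenGapSum_succ, ← hs] at h1
    rw [show n ⌈/⌉ 2 - 2 - s = r + 1 by omega] at h2
    have : 0 < 2 ^ (n - 7 - 2 * s) := by positivity
    omega

theorem breakpoint_one (n : ℕ) (hn : 9 ≤ n) :
    breakpoint n 1 = (11 * 2 ^ (n - 1)) ⌈/⌉ 48 := by
  have hc := ceilDiv_two n
  have h1 := breakpoint_add_evenGapSum n (n ⌈/⌉ 2 - 3) hn (by omega)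
  rw [show n ⌈/⌉ 2 - 2 - (n ⌈/⌉ 2 - 3) = 1 by omega] at h1
  have h2 := three_mul_evenGapSum (n - 7) (n ⌈/⌉ 2 - 3) (by omega)
  have h3 : 2 ^ (n - 3) = 16 * 2 ^ (n - 7) := by
    rw [show n - 3 = n - 7 + 4 by omega, pow_add]; ring
  have h4 : 2 ^ (n - 1) = 64 * 2 ^ (n - 7) := by
    rw [show n - 1 = n - 7 + 6 by omega, pow_add]; ring
  have h5 : 2 ^ (n - 7 + 2 - 2 * (n ⌈/⌉ 2 - 3)) = 1 ∨ 2 ^ (n - 7 + 2 - 2 * (n ⌈/⌉ 2 - 3)) = 2 := by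
    have : n - 7 + 2 - 2 * (n ⌈/⌉ 2 - 3) = 0 ∨ n - 7 + 2 - 2 * (n ⌈/⌉ 2 - 3) = 1 := by omega
    rcases this with h | h <;> simp [h]
  rw [Nat.ceilDiv_eq_add_pred_div, h4]
  omega

theorem ceilDiv_le_iff_three_mul_le (n m c : ℕ) (hn : 9 ≤ n) (h : m + c = 2 ^ (n - 3)) :
    (11 * 2 ^ (n - 1)) ⌈/⌉ 48 ≤ m ↔ 3 * c ≤ 4 * 2 ^ (n - 7) := by
  have h3 : 2 ^ (n - 3) = 16 * 2 ^ (n - 7) := by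
    rw [show n - 3 = n - 7 + 4 by omega, pow_add]; ring
  have h4 : 2 ^ (n - 1) = 64 * 2 ^ (n - 7) := by
    rw [show n - 1 = n - 7 + 6 by omega, pow_add]; ring
  rw [Nat.ceilDiv_eq_add_pred_div, h4]
  omega

/-- The candidate `(n + 1) m - 2 e(m)` for the least edge boundary of `m` vertices of `Q_{n,2}`
is at least `2 ^ (n - 1)`, and equal to it exactly at the breakpoints below `2 ^ (n - 1)`. -/
theorem two_pow_add_two_mul_cubeEdges_le (n m : ℕ) (hn : 9 ≤ n)
    (hm : (11 * 2 ^ (n - 1)) ⌈/⌉ 48 ≤ m) (hm' : m ≤ 2 ^ (n - 1)) :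
    2 ^ (n - 1) + 2 * cubeEdges m ≤ (n + 1) * m ∧
      (2 ^ (n - 1) + 2 * cubeEdges m = (n + 1) * m ↔
        ∃ r, 1 ≤ r ∧ r ≤ n ⌈/⌉ 2 - 2 ∧ m = breakpoint n r) := by
  have hcd := ceilDiv_two n
  rcases le_or_gt m (2 ^ (n - 3)) with h | h
  · obtain ⟨c, hc⟩ := Nat.exists_eq_add_of_le h
    have h1 := two_mul_cubeEdges_of_add_eq_two_pow (n - 3) m c hc.symm
    obtain ⟨h2, h3⟩ := two_mul_cubeEdges_le_of_three_mul_le (n - 7) c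
      ((ceilDiv_le_iff_three_mul_le n m c hn hc.symm).1 hm)
    have h4 : 2 ^ (n - 1) = 4 * 2 ^ (n - 3) := by
      rw [show n - 1 = n - 3 + 2 by omega, pow_add]; ring
    have h5 : (n + 1) * m = (n - 3) * m + 4 * m := by
      rw [← add_mul]; congr 1; omega
    have h6 : (n - 3) * c = (n - 7) * c + 4 * c := by
      rw [← add_mul]; congr 1; omega
    refine ⟨by omega, ?_⟩
    have h7 : 2 ^ (n - 1) + 2 * cubeEdges m = (n + 1) * m ↔
        2 * cubeEdges c = (n - 7) * c := by omega
    rw [h7, h3]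
    clear h3 h7
    constructor
    · rintro ⟨s, hs, rfl⟩
      have := breakpoint_add_evenGapSum n s hn (by omega)
      exact ⟨n ⌈/⌉ 2 - 2 - s, by omega, by omega, by omega⟩
    · rintro ⟨r, hr, hr', rfl⟩
      have := breakpoint_add_evenGapSum n (n ⌈/⌉ 2 - 2 - r) hn (by omega)
      rw [show n ⌈/⌉ 2 - 2 - (n ⌈/⌉ 2 - 2 - r) = r by omega] at this
      exact ⟨n ⌈/⌉ 2 - 2 - r, by omega, by omega⟩
  · have hlt : 2 ^ (n - 1) + 2 * cubeEdges m < (n + 1) * m := by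
      obtain ⟨k, rfl⟩ : ∃ k, n = k + 3 := ⟨n - 3, by omega⟩
      rw [show k + 3 - 3 = k by omega] at h
      rw [show k + 3 - 1 = k + 2 by omega, pow_add] at hm' ⊢
      rcases le_or_gt m (2 ^ (k + 1)) with h' | h' <;> rw [pow_succ] at h'
      · obtain ⟨t, rfl⟩ := Nat.exists_eq_add_of_le h.le
        have h1 := cubeEdges_two_pow_add k t (by omega)
        have h2 := two_mul_cubeEdges_two_pow k
        have h3 := (two_mul_cubeEdges_le k t (by omega)).1
        rw [h1]
        nlinarith
      · obtain ⟨t, rfl⟩ : ∃ t, m = 2 ^ (k + 1) + t :=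
          Nat.exists_eq_add_of_le (by rw [pow_succ]; omega)
        have hp : 2 ^ k * 2 ^ 2 = 2 * 2 ^ (k + 1) := by ring
        have h1 := cubeEdges_two_pow_add (k + 1) t (by omega)
        have h2 := two_mul_cubeEdges_two_pow (k + 1)
        have h3 := (two_mul_cubeEdges_le (k + 1) t (by omega)).1
        have h4 : 0 < 2 ^ (k + 1) := by positivity
        rw [hp, h1]
        nlinarith
    refine ⟨hlt.le, fun he => absurd he hlt.ne, ?_⟩
    rintro ⟨r, hr, hr', rfl⟩
    have := breakpoint_add_evenGapSum n (n ⌈/⌉ 2 - 2 - r) hn (by omega)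
    rw [show n ⌈/⌉ 2 - 2 - (n ⌈/⌉ 2 - 2 - r) = r by omega] at this
    omega

/-! ### Edge-isoperimetry in the folded hypercube -/

open Finset

/-- The neighbour of `x` in the hypercube obtained by complementing the bit `i`. -/
def flipBit {n : ℕ} (i : Fin n) (x : Fin n → Bool) : Fin n → Bool := Function.update x i (!(x i))

@[simp] theorem flipBit_flipBit {n : ℕ} (i : Fin n) (x : Fin n → Bool) :
    flipBit i (flipBit i x) = x := by
  simp [flipBit]

/-- Twice the number of edges of the hypercube inside `A`, counted as pairs of a vertex and a
direction. -/
def cubeDegreeSum {n : ℕ} (A : Finset (Fin n → Bool)) : ℕ := ∑ i, #{x ∈ A | flipBit i x ∈ A}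

/-- The number of vertices of `A` whose antipode lies in `A`, that is twice the number of
complementary edges inside `A`, when `A` is regarded as a vertex set of the folded hypercube. -/
def antipodalCount {n : ℕ} (A : Finset (Fin n → Bool)) : ℕ := #{x ∈ A | xᶜ ∈ A}

/-- The strings `x` such that `x` with `b` appended as its top bit lies in `A`. -/
def topSlice {n : ℕ} (A : Finset (Fin (n + 1) → Bool)) (b : Bool) : Finset (Fin n → Bool) :=
  {x | (Fin.snoc x b : Fin (n + 1) → Bool) ∈ A}

@[simp] theorem mem_topSlice {n : ℕ} {A : Finset (Fin (n + 1) → Bool)} {b : Bool}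
    {x : Fin n → Bool} : x ∈ topSlice A b ↔ (Fin.snoc x b : Fin (n + 1) → Bool) ∈ A := by
  simp [topSlice]

theorem card_filter_eq_snoc {n : ℕ} (p : (Fin (n + 1) → Bool) → Prop) [DecidablePred p] :
    #{x | p x} = #{x : Fin n → Bool | p (Fin.snoc x false)}
      + #{x : Fin n → Bool | p (Fin.snoc x true)} := by
  simp only [card_filter]
  rw [← Equiv.sum_comp (Fin.snocEquiv fun _ : Fin (n + 1) => Bool), Fintype.sum_prod_type,
    Fintype.sum_bool, add_comm]
  rfl

theorem card_eq_add_topSlice {n : ℕ} (A : Finset (Fin (n + 1) → Bool)) :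
    #A = #(topSlice A false) + #(topSlice A true) := by
  have := card_filter_eq_snoc fun x => x ∈ A
  simpa [topSlice] using this

theorem flipBit_castSucc_snoc {n : ℕ} (i : Fin n) (x : Fin n → Bool) (b : Bool) :
    flipBit i.castSucc (Fin.snoc x b : Fin (n + 1) → Bool) = Fin.snoc (flipBit i x) b := by
  simp [flipBit, Fin.snoc_update]

theorem flipBit_last_snoc {n : ℕ} (x : Fin n → Bool) (b : Bool) :
    flipBit (Fin.last n) (Fin.snoc x b : Fin (n + 1) → Bool) = Fin.snoc x (!b) := by
  simp [flipBit, Fin.update_snoc_last]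

theorem compl_snoc {n : ℕ} (x : Fin n → Bool) (b : Bool) :
    (Fin.snoc x b : Fin (n + 1) → Bool)ᶜ = Fin.snoc xᶜ (!b) := by
  ext j
  cases j using Fin.lastCases <;> simp

theorem card_filter_compl_mem {n : ℕ} (A B : Finset (Fin n → Bool)) :
    #{x ∈ A | xᶜ ∈ B} = #{x ∈ B | xᶜ ∈ A} := by
  refine card_nbij' (·ᶜ) (·ᶜ) ?_ ?_ ?_ ?_ <;> intro x <;> simp +contextual

theorem cubeDegreeSum_eq_topSlice {n : ℕ} (A : Finset (Fin (n + 1) → Bool)) :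
    cubeDegreeSum A = cubeDegreeSum (topSlice A false) + cubeDegreeSum (topSlice A true)
      + 2 * #(topSlice A false ∩ topSlice A true) := by
  have hfilter : ∀ i : Fin (n + 1), #{x ∈ A | flipBit i x ∈ A} =
      #{x : Fin n → Bool | (Fin.snoc x false : Fin (n + 1) → Bool) ∈ A ∧
          flipBit i (Fin.snoc x false : Fin (n + 1) → Bool) ∈ A}
        + #{x : Fin n → Bool | (Fin.snoc x true : Fin (n + 1) → Bool) ∈ A ∧
          flipBit i (Fin.snoc x true : Fin (n + 1) → Bool) ∈ A} := by
    intro i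
    rw [← card_filter_eq_snoc fun x => x ∈ A ∧ flipBit i x ∈ A]
    congr 1
    ext x
    simp
  have hslice : ∀ (b : Bool) (i : Fin n), #{x ∈ topSlice A b | flipBit i x ∈ topSlice A b} =
      #{x : Fin n → Bool | (Fin.snoc x b : Fin (n + 1) → Bool) ∈ A ∧
        (Fin.snoc (flipBit i x) b : Fin (n + 1) → Bool) ∈ A} := by
    intro b i
    congr 1
    ext x
    simp
  have hinter : topSlice A false ∩ topSlice A true =
      ({x | (Fin.snoc x false : Fin (n + 1) → Bool) ∈ A ∧
        (Fin.snoc x true : Fin (n + 1) → Bool) ∈ A} : Finset (Fin n → Bool)) := by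
    ext x
    simp
  have hinter' : topSlice A false ∩ topSlice A true =
      ({x | (Fin.snoc x true : Fin (n + 1) → Bool) ∈ A ∧
        (Fin.snoc x false : Fin (n + 1) → Bool) ∈ A} : Finset (Fin n → Bool)) := by
    ext x
    simp [and_comm]
  simp only [cubeDegreeSum, Fin.sum_univ_castSucc, hfilter, hslice, flipBit_castSucc_snoc,
    flipBit_last_snoc, Bool.not_false, Bool.not_true, sum_add_distrib]
  rw [← hinter, ← hinter']
  ring

theorem antipodalCount_eq_topSlice {n : ℕ} (A : Finset (Fin (n + 1) → Bool)) :
    antipodalCount A = 2 * #{x ∈ topSlice A true | xᶜ ∈ topSlice A false} := by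
  have h : antipodalCount A = #{x | x ∈ A ∧ xᶜ ∈ A} := by
    rw [antipodalCount]
    congr 1
    ext x
    simp
  have h2 : ∀ b, #{x : Fin n → Bool | (Fin.snoc x b : Fin (n + 1) → Bool) ∈ A ∧
      (Fin.snoc xᶜ (!b) : Fin (n + 1) → Bool) ∈ A}
        = #{x ∈ topSlice A b | xᶜ ∈ topSlice A (!b)} := by
    intro b
    congr 1
    ext x
    simp
  rw [h, card_filter_eq_snoc]
  simp only [compl_snoc]
  rw [h2, h2, Bool.not_true, Bool.not_false, card_filter_compl_mem (topSlice A false)]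
  ring

/-- The edges between two parts `P` and `R` of a folded hypercube, complementary ones included,
exceed `#R` only at the expense of complementary edges inside `P` and inside `R`. -/
theorem two_mul_card_inter_add_le {n : ℕ} (P R : Finset (Fin n → Bool)) :
    2 * (#(P ∩ R) + #{x ∈ R | xᶜ ∈ P}) ≤ 2 * #R + antipodalCount P + antipodalCount R := by
  -- `U` is the set of the vertices of `P` whose antipode lies in `P`, and it is symmetric.
  set U := {x ∈ P | xᶜ ∈ P} with hU
  set R' := {x ∈ U | xᶜ ∈ R} with hR'
  have h1 : #(P ∩ R) + #{x ∈ R | xᶜ ∈ P} ≤ #R + #(U ∩ R) := by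
    rw [← card_union_add_card_inter]
    refine add_le_add (card_le_card ?_) (card_le_card ?_)
    · intro x
      simp +contextual [or_imp]
    · intro x
      simp +contextual [hU]
  have h2 : #(U ∩ R) = #R' := by
    refine card_nbij' (·ᶜ) (·ᶜ) ?_ ?_ ?_ ?_ <;> intro x <;> simp +contextual [hU, hR']
  have h3 : #(U ∩ R) + #R' ≤ antipodalCount P + antipodalCount R := by
    rw [← card_union_add_card_inter, antipodalCount, antipodalCount]
    refine add_le_add (card_le_card ?_) (card_le_card ?_)
    · intro x
      simp +contextual [hU, hR', or_imp]
    · intro x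
      simp +contextual [hU, hR']
  omega

theorem card_filter_compl_le {n : ℕ} (P R : Finset (Fin n → Bool)) :
    #(P ∩ R) ≤ #R ∧ #(P ∩ R) ≤ #P ∧ #{x ∈ R | xᶜ ∈ P} ≤ #R ∧ #{x ∈ R | xᶜ ∈ P} ≤ #P :=
  ⟨card_le_card inter_subset_right, card_le_card inter_subset_left, card_filter_le _ _,
    by rw [← card_filter_compl_mem]; exact card_filter_le _ _⟩

theorem card_le_two_pow {n : ℕ} (A : Finset (Fin n → Bool)) : #A ≤ 2 ^ n := by
  simpa using card_le_univ A

/-- The edge-isoperimetric inequality of the hypercube. -/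
theorem cubeDegreeSum_le {n : ℕ} (A : Finset (Fin n → Bool)) :
    cubeDegreeSum A ≤ 2 * cubeEdges #A := by
  induction n with
  | zero => simp [cubeDegreeSum]
  | succ n ih =>
    have h1 := ih (topSlice A false)
    have h2 := ih (topSlice A true)
    have h3 := card_filter_compl_le (topSlice A false) (topSlice A true)
    have h4 := cubeEdges_add_le #(topSlice A false) #(topSlice A true)
    rw [cubeDegreeSum_eq_topSlice, card_eq_add_topSlice A]
    omega

/-- The arithmetic of the induction step for the folded hypercube, for parts of sizes `r ≤ p`;
here `2 * r + q` bounds twice the number of edges between the parts. -/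
theorem two_mul_cubeEdges_add_le (n p r q : ℕ) (hr : r ≤ p) (hp : p ≤ 2 ^ n) (hq : q ≤ 2 * r)
    (hq' : q ≤ (2 * p - 2 ^ n) + (2 * r - 2 ^ n)) :
    2 * cubeEdges p + 2 * cubeEdges r + 2 * r + q
      ≤ 2 * cubeEdges (p + r) + (2 * (p + r) - 2 ^ (n + 1)) := by
  have e2 : 2 ^ (n + 1) = 2 * 2 ^ n := pow_succ' 2 n
  have hsub := cubeEdges_add_le p r
  rcases n with _ | k
  · simp at *
    omega
  have e1 : 2 ^ (k + 1) = 2 * 2 ^ k := pow_succ' 2 k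
  have hdouble := cubeEdges_two_mul (2 ^ k)
  rw [← e1] at hdouble
  -- If `p` is at most half of its cube, no complementary edges are gained.
  rcases le_or_gt p (2 ^ k) with hpk | hpk
  · omega
  obtain ⟨t, rfl⟩ := Nat.exists_eq_add_of_le hpk.le
  have hpt := cubeEdges_two_pow_add k t (by omega)
  rcases le_or_gt r (2 ^ k) with hrk | hrk
  · have h1 := cubeEdges_add_le t r
    rcases le_or_gt (t + r) (2 ^ k) with hs | hs
    · have h2 := cubeEdges_two_pow_add k (t + r) hs
      rw [← add_assoc] at h2
      omega
    · obtain ⟨s, hs'⟩ := Nat.exists_eq_add_of_le hs.le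
      have h2 := cubeEdges_two_pow_add k s (by omega)
      have h3 := cubeEdges_two_pow_add (k + 1) s (by omega)
      rw [show 2 ^ k + t + r = 2 ^ (k + 1) + s by omega, h3]
      rw [hs', h2] at h1
      omega
  · obtain ⟨u, rfl⟩ := Nat.exists_eq_add_of_le hrk.le
    have hru := cubeEdges_two_pow_add k u (by omega)
    have h1 := cubeEdges_add_le t u
    have h3 := cubeEdges_two_pow_add (k + 1) (t + u) (by omega)
    rw [show 2 ^ k + t + (2 ^ k + u) = 2 ^ (k + 1) + (t + u) by omega, h3]
    omega

/-- The edge-isoperimetric inequality of the folded hypercube. Up to half of the vertices, the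
complementary edges do not help to enclose more edges than in the hypercube; the truncated
difference is the number of vertices beyond that half, doubled. -/
theorem cubeDegreeSum_add_antipodalCount_le {n : ℕ} (A : Finset (Fin n → Bool)) :
    cubeDegreeSum A + antipodalCount A ≤ 2 * cubeEdges #A + (2 * #A - 2 ^ n) := by
  induction n with
  | zero =>
    have h1 := card_le_two_pow A
    have h2 : antipodalCount A ≤ #A := card_filter_le _ _
    simp only [cubeDegreeSum, univ_eq_empty, sum_empty]
    simp at h1 ⊢
    omega
  | succ n ih =>
    rw [cubeDegreeSum_eq_topSlice, antipodalCount_eq_topSlice, card_eq_add_topSlice A]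
    generalize topSlice A false = P
    generalize topSlice A true = R
    have h1 := cubeDegreeSum_le P
    have h2 := cubeDegreeSum_le R
    have h3 := ih P
    have h4 := ih R
    have h5 := two_mul_card_inter_add_le P R
    have h6 := two_mul_card_inter_add_le R P
    rw [← card_filter_compl_mem, inter_comm] at h6
    have h7 := card_filter_compl_le P R
    have hP := card_le_two_pow P
    have hR := card_le_two_pow R
    rcases le_total #R #P with hle | hle
    · have := two_mul_cubeEdges_add_le n #P #R
        (min (2 * #R) ((2 * #P - 2 ^ n) + (2 * #R - 2 ^ n))) hle hP (min_le_left _ _)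
        (min_le_right _ _)
      omega
    · have := two_mul_cubeEdges_add_le n #R #P
        (min (2 * #P) ((2 * #R - 2 ^ n) + (2 * #P - 2 ^ n))) hle hR (min_le_left _ _)
        (min_le_right _ _)
      rw [add_comm #R #P] at this
      omega

/-! ### Edge boundaries in the enhanced hypercube -/

/-- The neighbours of `x` in `Q_{d+1,2}`: the index `some i` stands for the edge that complements
the bit `i`, and `none` for the edge that complements all bits but the top one. -/
def enhancedMove {d : ℕ} : Option (Fin (d + 1)) → (Fin (d + 1) → Bool) → Fin (d + 1) → Bool
  | some i, x => flipBit i x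
  | none, x => fun j => if j = Fin.last d then x j else !(x j)

theorem enhancedMove_none_snoc {d : ℕ} (x : Fin d → Bool) (b : Bool) :
    enhancedMove none (Fin.snoc x b : Fin (d + 1) → Bool) = Fin.snoc xᶜ b := by
  ext j
  cases j using Fin.lastCases <;> simp [enhancedMove]

theorem enhancedMove_left_injective {d : ℕ} (hd : 2 ≤ d) (x : Fin (d + 1) → Bool) :
    Function.Injective fun g => enhancedMove g x := by
  -- The complementary move changes two bits other than the top one.
  have key : ∀ i, enhancedMove none x ≠ flipBit i x := by
    intro i h
    obtain ⟨j, hj, hji⟩ : ∃ j : Fin (d + 1), j ≠ Fin.last d ∧ j ≠ i := by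
      by_cases hi : i = ⟨0, by omega⟩
      · exact ⟨⟨1, by omega⟩, by simp [Fin.ext_iff]; omega, by simp [hi]⟩
      · exact ⟨⟨0, by omega⟩, by simp [Fin.ext_iff]; omega, fun h => hi h.symm⟩
    have := congrFun h j
    simp [enhancedMove, flipBit, hj, hji] at this
  rintro (_ | i) (_ | j) h
  · rfl
  · exact absurd h (key j)
  · exact absurd h.symm (key i)
  · have := congrFun h i
    by_contra hij
    have hij : i ≠ j := fun h => hij (by rw [h])
    simp [enhancedMove, flipBit, hij] at this

theorem enhancedMove_ne {d : ℕ} (hd : 1 ≤ d) (g : Option (Fin (d + 1))) (x : Fin (d + 1) → Bool) :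
    enhancedMove g x ≠ x := by
  intro h
  rcases g with _ | i
  · have := congrFun h 0
    simp [enhancedMove, Fin.ext_iff, show 0 ≠ d by omega] at this
  · have := congrFun h i
    simp [enhancedMove, flipBit] at this

theorem enhancedHypercube_adj_iff {d : ℕ} (hd : 1 ≤ d) (x y : Fin (d + 1) → Bool) :
    (enhancedHypercube (d + 1) 2).Adj x y ↔ ∃ g, y = enhancedMove g x := by
  have hnone : (fun j : Fin (d + 1) => if (j : ℕ) + 1 ≤ d + 1 - 2 + 1 then !(x j) else x j)
      = enhancedMove none x := by
    ext j
    have : (j : ℕ) + 1 ≤ d + 1 - 2 + 1 ↔ ¬ j = Fin.last d := by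
      rw [Fin.ext_iff, Fin.val_last]
      omega
    simp only [enhancedMove, this, ite_not]
  change (x ≠ y ∧ ((∃ i, y = flipBit i x) ∨ y = _)) ↔ _
  rw [hnone]
  constructor
  · rintro ⟨-, ⟨i, rfl⟩ | rfl⟩
    exacts [⟨some i, rfl⟩, ⟨none, rfl⟩]
  · rintro ⟨g, rfl⟩
    refine ⟨(enhancedMove_ne hd g x).symm, ?_⟩
    rcases g with _ | i
    exacts [Or.inr rfl, Or.inl ⟨i, rfl⟩]

theorem card_enhancedMove_none_mem {d : ℕ} (X : Finset (Fin (d + 1) → Bool)) :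
    #{x ∈ X | enhancedMove none x ∈ X}
      = antipodalCount (topSlice X false) + antipodalCount (topSlice X true) := by
  have h : #{x ∈ X | enhancedMove none x ∈ X} = #{x | x ∈ X ∧ enhancedMove none x ∈ X} := by
    congr 1
    ext x
    simp
  have h2 : ∀ b, #{x : Fin d → Bool | (Fin.snoc x b : Fin (d + 1) → Bool) ∈ X ∧
      (Fin.snoc xᶜ b : Fin (d + 1) → Bool) ∈ X} = antipodalCount (topSlice X b) := by
    intro b
    rw [antipodalCount]
    congr 1
    ext x
    simp
  rw [h, card_filter_eq_snoc]
  simp only [enhancedMove_none_snoc]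
  rw [h2, h2]

/-- The edge boundary in the `(d + 2)`-regular graph `Q_{d+1,2}`, computed from the number of edges
inside `X`. -/
theorem ncard_edgeBoundary_add {d : ℕ} (hd : 2 ≤ d) (X : Finset (Fin (d + 1) → Bool)) :
    (edgeBoundary (enhancedHypercube (d + 1) 2) (X : Set (Fin (d + 1) → Bool))).ncard
      + (cubeDegreeSum X + (antipodalCount (topSlice X false) + antipodalCount (topSlice X true)))
      = (d + 2) * #X := by
  have h1 : edgeBoundary (enhancedHypercube (d + 1) 2) (X : Set (Fin (d + 1) → Bool)) =
      (fun p : Option (Fin (d + 1)) × (Fin (d + 1) → Bool) => s(p.2, enhancedMove p.1 p.2)) ''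
        (univ.sigma fun g => {x ∈ X | enhancedMove g x ∉ X} :
          Finset (Σ _ : Option (Fin (d + 1)), Fin (d + 1) → Bool)).map
            (Equiv.sigmaEquivProd _ _).toEmbedding := by
    ext e
    simp only [edgeBoundary, Set.mem_ofPred_eq, Set.mem_image, Finset.coe_map, Finset.mem_coe]
    constructor
    · rintro ⟨he, u, hu, v, hv, rfl⟩
      rw [SimpleGraph.mem_edgeSet, enhancedHypercube_adj_iff (by omega)] at he
      obtain ⟨g, rfl⟩ := he
      exact ⟨(g, u), ⟨⟨g, u⟩, by simpa using ⟨hu, hv⟩, rfl⟩, rfl⟩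
    · rintro ⟨_, ⟨⟨g, u⟩, h, rfl⟩, rfl⟩
      simp only [mem_sigma, mem_univ, true_and, mem_filter] at h
      refine ⟨?_, u, h.1, enhancedMove g u, h.2, rfl⟩
      exact (enhancedHypercube_adj_iff (by omega) _ _).2 ⟨g, rfl⟩
  rw [h1, Set.InjOn.ncard_image, Set.ncard_coe_finset, card_map, card_sigma,
    ← card_enhancedMove_none_mem]
  · have h2 : ∀ g, #{x ∈ X | enhancedMove g x ∉ X} + #{x ∈ X | enhancedMove g x ∈ X} = #X := by
      intro g
      rw [add_comm]
      exact card_filter_add_card_filter_not _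
    have h3 : cubeDegreeSum X + #{x ∈ X | enhancedMove none x ∈ X}
        = ∑ g, #{x ∈ X | enhancedMove g x ∈ X} := by
      rw [Fintype.sum_option, add_comm]
      rfl
    rw [h3, ← sum_add_distrib, sum_congr rfl fun g _ => h2 g]
    simp
  · rintro ⟨g, u⟩ h ⟨g', u'⟩ h' he
    simp only [Finset.coe_map, Set.mem_image, Finset.mem_coe, mem_sigma, mem_univ, true_and,
      mem_filter, Sigma.exists, Equiv.coe_toEmbedding, Equiv.sigmaEquivProd_apply, Prod.mk.injEq,
      exists_eq_right_right, exists_eq_right] at h h'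
    simp only [Sym2.eq_iff] at he
    rcases he with ⟨rfl, he⟩ | ⟨rfl, -⟩
    · rw [enhancedMove_left_injective hd u he]
    · exact absurd h.1 h'.2

/-- The lower bound for the edge boundary in `Q_{d+1,2}`. If neither of the two slices of `X` fills
more than half of its copy of the folded hypercube, then complementary edges gain nothing and `X`
has at least as many boundary edges as an initial segment of the same size inside a cube. Otherwise
there are more than `2 ^ d` boundary edges, unless `X` is a whole copy. -/
theorem le_ncard_edgeBoundary {d : ℕ} (hd : 2 ≤ d) (X : Finset (Fin (d + 1) → Bool))
    (hX : #X ≤ 2 ^ d) :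
    (d + 2) * #X ≤ (edgeBoundary (enhancedHypercube (d + 1) 2)
        (X : Set (Fin (d + 1) → Bool))).ncard + 2 * cubeEdges #X ∨
      2 ^ d < (edgeBoundary (enhancedHypercube (d + 1) 2) (X : Set (Fin (d + 1) → Bool))).ncard ∨
      #X = 2 ^ d ∧ 2 ^ d ≤ (edgeBoundary (enhancedHypercube (d + 1) 2)
        (X : Set (Fin (d + 1) → Bool))).ncard := by
  have h := ncard_edgeBoundary_add hd X
  rw [cubeDegreeSum_eq_topSlice] at h
  generalize (edgeBoundary (enhancedHypercube (d + 1) 2) (X : Set (Fin (d + 1) → Bool))).ncard = E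
    at h ⊢
  have hcard := card_eq_add_topSlice X
  have h1 := cubeDegreeSum_add_antipodalCount_le (topSlice X false)
  have h2 := cubeDegreeSum_add_antipodalCount_le (topSlice X true)
  have h3 := card_filter_compl_le (topSlice X false) (topSlice X true)
  have h4 := cubeEdges_add_le #(topSlice X false) #(topSlice X true)
  obtain ⟨k, rfl⟩ : ∃ k, d = k + 1 := ⟨d - 1, by omega⟩
  have h5 := two_mul_cubeEdges_le (k + 1) #(topSlice X false) (card_le_two_pow _)
  have h6 := two_mul_cubeEdges_le (k + 1) #(topSlice X true) (card_le_two_pow _)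
  rw [hcard] at h hX ⊢
  generalize #(topSlice X false) = a at *
  generalize #(topSlice X true) = b at *
  have e : (k + 1 + 2) * (a + b) = (k + 1) * a + (k + 1) * b + 2 * (a + b) := by ring
  have e2 : 2 ^ (k + 1) = 2 * 2 ^ k := pow_succ' 2 k
  rcases le_or_gt a (2 ^ k) with ha | ha
  · rcases le_or_gt b (2 ^ k) with hb | hb
    · left
      omega
    · right
      have h7 := two_mul_cubeEdges_le k a (by omega)
      have e3 : (k + 1) * a = k * a + a := by ring
      omega
  · right
    have h7 := two_mul_cubeEdges_le k b (by omega)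
    have e3 : (k + 1) * b = k * b + b := by ring
    omega

/-! ### Initial segments of the binary order -/

/-- The number with binary expansion `x`. -/
def binaryValue {n : ℕ} (x : Fin n → Bool) : ℕ := ∑ i, if x i then 2 ^ (i : ℕ) else 0

theorem binaryValue_snoc {n : ℕ} (x : Fin n → Bool) (b : Bool) :
    binaryValue (Fin.snoc x b : Fin (n + 1) → Bool)
      = binaryValue x + if b then 2 ^ n else 0 := by
  simp [binaryValue, Fin.sum_univ_castSucc]

theorem binaryValue_lt {n : ℕ} (x : Fin n → Bool) : binaryValue x < 2 ^ n := by
  induction n with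
  | zero => simp [binaryValue]
  | succ n ih =>
    rw [← Fin.snoc_init_self x, binaryValue_snoc, pow_succ]
    have := ih (Fin.init x)
    split_ifs <;> omega

theorem binaryValue_flipBit_lt {n : ℕ} (x : Fin n → Bool) (i : Fin n) (hi : x i = true) :
    binaryValue (flipBit i x) < binaryValue x := by
  refine sum_lt_sum (fun j _ => ?_) ⟨i, mem_univ i, by simp [flipBit, hi]⟩
  by_cases h : j = i
  · subst h
    simp [flipBit, hi]
  · simp [flipBit, h]

theorem binaryValue_lt_flipBit {n : ℕ} (x : Fin n → Bool) (i : Fin n) (hi : x i = false) :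
    binaryValue x < binaryValue (flipBit i x) := by
  have := binaryValue_flipBit_lt (flipBit i x) i (by simp [flipBit, hi])
  simpa using this

/-- The first `m` binary strings of length `n` in the binary order. -/
def initialSegment (n m : ℕ) : Finset (Fin n → Bool) := {x | binaryValue x < m}

@[simp] theorem mem_initialSegment {n m : ℕ} {x : Fin n → Bool} :
    x ∈ initialSegment n m ↔ binaryValue x < m := by
  simp [initialSegment]

theorem initialSegment_eq_univ {n m : ℕ} (h : 2 ^ n ≤ m) : initialSegment n m = univ := by
  ext x
  have := binaryValue_lt x
  simp
  omega

theorem topSlice_initialSegment_false (n m : ℕ) :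
    topSlice (initialSegment (n + 1) m) false = initialSegment n m := by
  ext x
  simp [binaryValue_snoc]

theorem topSlice_initialSegment_true (n m : ℕ) :
    topSlice (initialSegment (n + 1) m) true = initialSegment n (m - 2 ^ n) := by
  ext x
  simp [binaryValue_snoc]
  omega

theorem card_initialSegment (n m : ℕ) (hm : m ≤ 2 ^ n) : #(initialSegment n m) = m := by
  induction n generalizing m with
  | zero =>
    have hm : m = 0 ∨ m = 1 := by simp at hm; omega
    rcases hm with rfl | rfl <;> simp [initialSegment, binaryValue]
  | succ n ih =>
    rw [card_eq_add_topSlice, topSlice_initialSegment_false, topSlice_initialSegment_true]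
    rw [pow_succ] at hm
    rcases le_or_gt m (2 ^ n) with h | h
    · rw [ih m h, Nat.sub_eq_zero_of_le h, ih 0 (by omega)]
      omega
    · rw [ih (m - 2 ^ n) (by omega), initialSegment_eq_univ h.le]
      simp
      omega

theorem initialSegment_zero (n : ℕ) : initialSegment n 0 = ∅ := by
  ext x
  simp

theorem cubeDegreeSum_initialSegment (n m : ℕ) (hm : m ≤ 2 ^ n) :
    cubeDegreeSum (initialSegment n m) = 2 * cubeEdges m := by
  induction n generalizing m with
  | zero =>
    have hm : m = 0 ∨ m = 1 := by simp at hm; omega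
    rcases hm with rfl | rfl <;> simp [cubeDegreeSum]
  | succ n ih =>
    rw [cubeDegreeSum_eq_topSlice, topSlice_initialSegment_false, topSlice_initialSegment_true]
    rw [pow_succ] at hm
    rcases le_or_gt m (2 ^ n) with h | h
    · rw [ih m h, Nat.sub_eq_zero_of_le h, ih 0 (by omega), initialSegment_zero]
      simp
    · rw [ih (m - 2 ^ n) (by omega), initialSegment_eq_univ h.le,
        ← initialSegment_eq_univ (n := n) le_rfl, ih _ le_rfl, initialSegment_eq_univ le_rfl,
        univ_inter, card_initialSegment n _ (by omega)]
      have := cubeEdges_two_pow_add n (m - 2 ^ n) (by omega)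
      rw [Nat.add_sub_cancel' h.le] at this
      omega

/-- Initial segments attain the lower bound `(n + 1) m - 2 e(m)` for the edge boundary. -/
theorem ncard_edgeBoundary_initialSegment_le {d : ℕ} (hd : 2 ≤ d) (m : ℕ) (hm : m ≤ 2 ^ d) :
    (edgeBoundary (enhancedHypercube (d + 1) 2)
      (initialSegment (d + 1) m : Set (Fin (d + 1) → Bool))).ncard + 2 * cubeEdges m
        ≤ (d + 2) * m := by
  have hm' : m ≤ 2 ^ (d + 1) := by rw [pow_succ]; omega
  have h := ncard_edgeBoundary_add hd (initialSegment (d + 1) m)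
  rw [card_initialSegment _ _ hm', cubeDegreeSum_initialSegment _ _ hm'] at h
  omega

/-- The half `x_n = 0` of the vertices is a folded hypercube, and only the edges in the top
direction leave it. -/
theorem ncard_edgeBoundary_initialSegment_two_pow_le {d : ℕ} (hd : 2 ≤ d) :
    (edgeBoundary (enhancedHypercube (d + 1) 2)
      (initialSegment (d + 1) (2 ^ d) : Set (Fin (d + 1) → Bool))).ncard ≤ 2 ^ d := by
  have hm' : 2 ^ d ≤ 2 ^ (d + 1) := by rw [pow_succ]; omega
  have h := ncard_edgeBoundary_add hd (initialSegment (d + 1) (2 ^ d))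
  rw [card_initialSegment _ _ hm', cubeDegreeSum_initialSegment _ _ hm',
    topSlice_initialSegment_false, initialSegment_eq_univ le_rfl, two_mul_cubeEdges_two_pow] at h
  simp only [antipodalCount, mem_univ, filter_true, card_univ, Fintype.card_pi, Fintype.card_bool,
    prod_const, Fintype.card_fin] at h
  nlinarith

/-! ### Connectedness of initial segments -/

theorem induce_connected_of_descent {V : Type*} (G : SimpleGraph V) (X : Set V) (r : V)
    (hr : r ∈ X) (μ : V → ℕ) (h : ∀ x ∈ X, x ≠ r → ∃ y ∈ X, G.Adj x y ∧ μ y < μ x) :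
    (G.induce X).Connected := by
  have key : ∀ k (x : X), μ x = k → (G.induce X).Reachable x ⟨r, hr⟩ := by
    intro k
    induction k using Nat.strong_induction_on with
    | _ k ih =>
      rintro ⟨x, hx⟩ rfl
      by_cases hxr : x = r
      · subst hxr
        exact SimpleGraph.Reachable.refl _
      · obtain ⟨y, hy, hadj, hlt⟩ := h x hx hxr
        have hadj' : (G.induce X).Adj ⟨x, hx⟩ ⟨y, hy⟩ := hadj
        exact hadj'.reachable.trans (ih (μ y) hlt ⟨y, hy⟩ rfl)
  have : Nonempty X := ⟨⟨r, hr⟩⟩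
  exact ⟨fun x y => (key _ x rfl).trans (key _ y rfl).symm⟩

theorem induce_initialSegment_connected {d : ℕ} (hd : 1 ≤ d) (m : ℕ) (hm : 0 < m) :
    ((enhancedHypercube (d + 1) 2).induce
      (initialSegment (d + 1) m : Set (Fin (d + 1) → Bool))).Connected := by
  refine induce_connected_of_descent _ _ (fun _ => false) ?_ binaryValue ?_
  · simpa [binaryValue] using hm
  · intro x hx hne
    obtain ⟨i, hi⟩ := Function.ne_iff.1 hne
    have hlt := binaryValue_flipBit_lt x i (by simpa using hi)
    refine ⟨flipBit i x, ?_, (enhancedHypercube_adj_iff hd _ _).2 ⟨some i, rfl⟩, hlt⟩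
    simp at hx ⊢
    omega

theorem induce_compl_initialSegment_connected {d : ℕ} (hd : 1 ≤ d) (m : ℕ)
    (hm : m < 2 ^ (d + 1)) :
    ((enhancedHypercube (d + 1) 2).induce
      (initialSegment (d + 1) m : Set (Fin (d + 1) → Bool))ᶜ).Connected := by
  have htrue : ∀ n, binaryValue (fun _ : Fin n => true) + 1 = 2 ^ n := by
    intro n
    induction n with
    | zero => simp [binaryValue]
    | succ n ih =>
      have h := binaryValue_snoc (fun _ : Fin n => true) true
      have h2 : (Fin.snoc (fun _ : Fin n => true) true : Fin (n + 1) → Bool) = fun _ => true := by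
        ext j
        cases j using Fin.lastCases <;> simp
      rw [h2, if_pos rfl] at h
      rw [h, pow_succ]
      omega
  refine induce_connected_of_descent _ _ (fun _ => true) ?_
    (fun x => 2 ^ (d + 1) - binaryValue x) ?_
  · have := htrue (d + 1)
    simp
    omega
  · intro x hx hne
    obtain ⟨i, hi⟩ := Function.ne_iff.1 hne
    have hlt := binaryValue_lt_flipBit x i (by simpa using hi)
    have := binaryValue_lt (flipBit i x)
    refine ⟨flipBit i x, ?_, (enhancedHypercube_adj_iff hd _ _).2 ⟨some i, rfl⟩, ?_⟩
    · simp at hx ⊢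
      omega
    · omega

/-! ### Extra edge-cuts and edge boundaries -/

/-- If both sides of an edge boundary are connected, then it is an extra edge-cut, whose components
are the two sides. -/
theorem isExtraEdgeCut_edgeBoundary {V : Type*} [Finite V] (G : SimpleGraph V) (X : Set V)
    (hX : (G.induce X).Connected) (hXc : (G.induce Xᶜ).Connected) (h : ℕ) (h1 : h ≤ X.ncard)
    (h2 : h ≤ Xᶜ.ncard) (F : Finset (Sym2 V)) (hF : (F : Set (Sym2 V)) = edgeBoundary G X) :
    IsExtraEdgeCut G h F := by
  rw [IsExtraEdgeCut, hF]
  have hstep : ∀ u v, (G.deleteEdges (edgeBoundary G X)).Adj u v → (u ∈ X ↔ v ∈ X) := by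
    intro u v huv
    rw [SimpleGraph.deleteEdges_adj] at huv
    obtain ⟨hadj, hn⟩ := huv
    by_contra hne
    rcases not_iff.1 hne with hne
    by_cases hu : u ∈ X
    · exact hn ⟨hadj, u, hu, v, by tauto, rfl⟩
    · exact hn ⟨hadj, v, by tauto, u, hu, Sym2.eq_swap⟩
  have hreach : ∀ u v, (G.deleteEdges (edgeBoundary G X)).Reachable u v → (u ∈ X ↔ v ∈ X) := by
    rintro u v ⟨p⟩
    induction p with
    | nil => rfl
    | cons hadj _ ih => exact (hstep _ _ hadj).trans ih
  have hside : ∀ Y : Set V, (∀ u ∈ Y, ∀ v ∈ Y, (u ∈ X ↔ v ∈ X)) → (G.induce Y).Connected →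
      ∀ u ∈ Y, ∀ v ∈ Y, (G.deleteEdges (edgeBoundary G X)).Reachable u v := by
    intro Y hY hconn u hu v hv
    let φ : G.induce Y →g G.deleteEdges (edgeBoundary G X) :=
      { toFun := Subtype.val
        map_rel' := by
          rintro ⟨a, ha⟩ ⟨b, hb⟩ hab
          rw [SimpleGraph.deleteEdges_adj]
          refine ⟨hab, ?_⟩
          rintro ⟨-, p, hp, q, hq, he⟩
          have := hY a ha b hb
          rcases Sym2.eq_iff.1 he with ⟨rfl, rfl⟩ | ⟨rfl, rfl⟩ <;> tauto }
    exact (hconn.preconnected ⟨u, hu⟩ ⟨v, hv⟩).map φ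
  refine ⟨fun e he => he.1, fun hconn => ?_, fun c => ?_⟩
  · obtain ⟨⟨x, hx⟩⟩ := hX.nonempty
    obtain ⟨⟨y, hy⟩⟩ := hXc.nonempty
    exact hy ((hreach x y (hconn.preconnected x y)).1 hx)
  · obtain ⟨v, rfl⟩ := c.exists_rep
    by_cases hv : v ∈ X
    · refine h1.trans (Set.ncard_le_ncard (fun u hu => ?_) (Set.toFinite _))
      exact SimpleGraph.ConnectedComponent.sound
        (hside X (fun _ _ _ _ => by tauto) hX u hu v hv)
    · refine h2.trans (Set.ncard_le_ncard (fun u hu => ?_) (Set.toFinite _))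
      exact SimpleGraph.ConnectedComponent.sound
        (hside Xᶜ (fun a ha b hb => iff_of_false ha hb) hXc u hu v hv)

/-- An extra edge-cut contains the edge boundary of a component with at most half of the
vertices. -/
theorem IsExtraEdgeCut.exists_edgeBoundary_subset {V : Type*} [Finite V] [Nonempty V]
    {G : SimpleGraph V} {h : ℕ} {F : Finset (Sym2 V)} (hF : IsExtraEdgeCut G h F) :
    ∃ X : Set V, h ≤ X.ncard ∧ 2 * X.ncard ≤ Nat.card V ∧
      (edgeBoundary G X).ncard ≤ F.card := by
  obtain ⟨-, hdisc, hcomp⟩ := hF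
  have hboundary : ∀ c : (G.deleteEdges (F : Set (Sym2 V))).ConnectedComponent,
      (edgeBoundary G c.supp).ncard ≤ F.card := by
    intro c
    rw [← Set.ncard_coe_finset]
    refine Set.ncard_le_ncard ?_ (Set.toFinite _)
    rintro _ ⟨hadj, u, hu, v, hv, rfl⟩
    by_contra hn
    have : (G.deleteEdges (F : Set (Sym2 V))).Adj u v := by
      rw [SimpleGraph.deleteEdges_adj]
      exact ⟨hadj, hn⟩
    refine hv ?_
    rw [SimpleGraph.ConnectedComponent.mem_supp_iff] at hu ⊢
    rw [← hu]
    exact SimpleGraph.ConnectedComponent.sound this.symm.reachable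
  have hpre : ¬ (G.deleteEdges (F : Set (Sym2 V))).Preconnected := fun hp => hdisc ⟨hp⟩
  simp only [SimpleGraph.Preconnected, not_forall] at hpre
  obtain ⟨u, v, huv⟩ := hpre
  set c := (G.deleteEdges (F : Set (Sym2 V))).connectedComponentMk u with hc
  set c' := (G.deleteEdges (F : Set (Sym2 V))).connectedComponentMk v with hc'
  have hdisj : Disjoint c.supp c'.supp := by
    rw [Set.disjoint_left]
    intro w hw hw'
    rw [SimpleGraph.ConnectedComponent.mem_supp_iff] at hw hw'
    exact huv (SimpleGraph.ConnectedComponent.exact (hw.symm.trans hw'))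
  have hsum : c.supp.ncard + c'.supp.ncard ≤ Nat.card V := by
    rw [← Set.ncard_union_eq hdisj (Set.toFinite _) (Set.toFinite _), ← Set.ncard_univ]
    exact Set.ncard_le_ncard (Set.subset_univ _) (Set.toFinite _)
  rcases le_total c.supp.ncard c'.supp.ncard with hle | hle
  · exact ⟨c.supp, hcomp c, by omega, hboundary c⟩
  · exact ⟨c'.supp, hcomp c', by omega, hboundary c'⟩

/-! ### The values of `ξ` and `λ` -/

/-- Between the first and the last breakpoint every edge boundary has at least `2 ^ d` edges, and
exactly `2 ^ d` can occur only at a breakpoint. -/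
theorem two_pow_le_ncard_edgeBoundary {d : ℕ} (hd : 8 ≤ d) (X : Set (Fin (d + 1) → Bool))
    (hX : (11 * 2 ^ d) ⌈/⌉ 48 ≤ X.ncard) (hX' : X.ncard ≤ 2 ^ d) :
    2 ^ d ≤ (edgeBoundary (enhancedHypercube (d + 1) 2) X).ncard ∧
      ((edgeBoundary (enhancedHypercube (d + 1) 2) X).ncard = 2 ^ d →
        ∃ r, 1 ≤ r ∧ r ≤ (d + 1) ⌈/⌉ 2 - 1 ∧ X.ncard = breakpoint (d + 1) r) := by
  have hcd := ceilDiv_two (d + 1)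
  lift X to Finset (Fin (d + 1) → Bool) using X.toFinite
  rw [Set.ncard_coe_finset] at hX hX' ⊢
  have h1 := le_ncard_edgeBoundary (by omega) X hX'
  obtain ⟨h2, h3⟩ := two_pow_add_two_mul_cubeEdges_le (d + 1) #X (by omega) hX hX'
  rw [Nat.add_sub_cancel] at h2 h3
  have e : d + 1 + 1 = d + 2 := rfl
  rw [e] at h2 h3
  rcases h1 with h1 | h1 | ⟨h1, h1'⟩
  · refine ⟨by omega, fun he => ?_⟩
    obtain ⟨r, hr, hr', h⟩ := h3.1 (by omega)
    exact ⟨r, hr, by omega, h⟩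
  · exact ⟨h1.le, fun he => absurd he h1.ne'⟩
  · refine ⟨h1', fun _ => ⟨(d + 1) ⌈/⌉ 2 - 1, by omega, le_rfl, ?_⟩⟩
    rw [breakpoint_last _ (by omega), h1, Nat.add_sub_cancel]

theorem initialSegment_mem_minEdgeBoundary {d : ℕ} (hd : 1 ≤ d) (m : ℕ) (hm : 0 < m)
    (hm' : m ≤ 2 ^ d) :
    (edgeBoundary (enhancedHypercube (d + 1) 2)
      (initialSegment (d + 1) m : Set (Fin (d + 1) → Bool))).ncard ∈
      {c : ℕ | ∃ X : Set (Fin (d + 1) → Bool), X.ncard = m ∧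
        m ≤ Nat.card (Fin (d + 1) → Bool) / 2 ∧
        ((enhancedHypercube (d + 1) 2).induce X).Connected ∧
        ((enhancedHypercube (d + 1) 2).induce Xᶜ).Connected ∧
        (edgeBoundary (enhancedHypercube (d + 1) 2) X).ncard = c} := by
  have e : 2 ^ (d + 1) = 2 * 2 ^ d := pow_succ' 2 d
  have hpos : 0 < 2 ^ d := by positivity
  refine ⟨_, ?_, ?_, induce_initialSegment_connected hd m hm,
    induce_compl_initialSegment_connected hd m (by omega), rfl⟩
  · rw [Set.ncard_coe_finset, card_initialSegment _ _ (by omega)]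
  · simp
    omega

theorem exists_ncard_edgeBoundary_eq_minEdgeBoundary {d : ℕ} (hd : 1 ≤ d) (m : ℕ) (hm : 0 < m)
    (hm' : m ≤ 2 ^ d) :
    ∃ X : Set (Fin (d + 1) → Bool), X.ncard = m ∧
      (edgeBoundary (enhancedHypercube (d + 1) 2) X).ncard
        = minEdgeBoundary (enhancedHypercube (d + 1) 2) m := by
  obtain ⟨X, h1, -, -, -, h2⟩ :=
    Nat.sInf_mem ⟨_, initialSegment_mem_minEdgeBoundary hd m hm hm'⟩
  exact ⟨X, h1, h2⟩

theorem two_pow_le_minEdgeBoundary {d : ℕ} (hd : 8 ≤ d) (m : ℕ)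
    (hm : (11 * 2 ^ d) ⌈/⌉ 48 ≤ m) (hm' : m ≤ 2 ^ d) :
    2 ^ d ≤ minEdgeBoundary (enhancedHypercube (d + 1) 2) m ∧
      (minEdgeBoundary (enhancedHypercube (d + 1) 2) m = 2 ^ d ↔
        ∃ r, 1 ≤ r ∧ r ≤ (d + 1) ⌈/⌉ 2 - 1 ∧ m = breakpoint (d + 1) r) := by
  have hpos : 0 < m := by
    have : 0 < 2 ^ d := by positivity
    rw [Nat.ceilDiv_eq_add_pred_div] at hm
    omega
  obtain ⟨X, rfl, hX⟩ := exists_ncard_edgeBoundary_eq_minEdgeBoundary (by omega) m hpos hm'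
  obtain ⟨h1, h2⟩ := two_pow_le_ncard_edgeBoundary hd X hm hm'
  rw [hX] at h1 h2
  refine ⟨h1, h2, ?_⟩
  rintro ⟨r, hr, hr', h⟩
  refine le_antisymm ?_ h1
  refine (Nat.sInf_le (initialSegment_mem_minEdgeBoundary (by omega) _ hpos hm')).trans ?_
  rcases hr'.lt_or_eq with hlt | rfl
  · have h3 := (two_pow_add_two_mul_cubeEdges_le (d + 1) X.ncard (by omega) hm hm').2.2
      ⟨r, hr, by omega, h⟩
    have h4 := ncard_edgeBoundary_initialSegment_le (d := d) (by omega) X.ncard hm'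
    rw [Nat.add_sub_cancel, show d + 1 + 1 = d + 2 from rfl] at h3
    omega
  · rw [h, breakpoint_last _ (by omega)]
    exact ncard_edgeBoundary_initialSegment_two_pow_le (by omega)

theorem extraEdgeConnectivity_eq_two_pow {d : ℕ} (hd : 8 ≤ d) (h : ℕ)
    (hh : (11 * 2 ^ d) ⌈/⌉ 48 ≤ h) (hh' : h ≤ 2 ^ d) :
    extraEdgeConnectivity (enhancedHypercube (d + 1) 2) h = 2 ^ d := by
  have e : 2 ^ (d + 1) = 2 * 2 ^ d := pow_succ' 2 d
  have hpos : 0 < 2 ^ d := by positivity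
  have hmem : ∃ F : Finset (Sym2 (Fin (d + 1) → Bool)),
      IsExtraEdgeCut (enhancedHypercube (d + 1) 2) h F ∧ F.card ≤ 2 ^ d := by
    have hcard := card_initialSegment (d + 1) (2 ^ d) (by omega)
    obtain ⟨F, hF⟩ := (Set.toFinite (edgeBoundary (enhancedHypercube (d + 1) 2)
      (initialSegment (d + 1) (2 ^ d) : Set (Fin (d + 1) → Bool)))).exists_finset_coe
    refine ⟨F, isExtraEdgeCut_edgeBoundary _ _
      (induce_initialSegment_connected (by omega) _ hpos)
      (induce_compl_initialSegment_connected (by omega) _ (by omega)) h ?_ ?_ F hF, ?_⟩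
    · rwa [Set.ncard_coe_finset, hcard]
    · rw [Set.ncard_compl, Set.ncard_coe_finset, hcard]
      simp
      omega
    · rw [← Set.ncard_coe_finset, hF]
      exact ncard_edgeBoundary_initialSegment_two_pow_le (by omega)
  obtain ⟨F, hF, hFcard⟩ := hmem
  have hle : extraEdgeConnectivity (enhancedHypercube (d + 1) 2) h ≤ #F :=
    Nat.sInf_le ⟨F, hF, rfl⟩
  refine le_antisymm (hle.trans hFcard) ?_
  rw [extraEdgeConnectivity]
  refine le_csInf ⟨F.card, F, hF, rfl⟩ ?_
  rintro _ ⟨F', hF', rfl⟩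
  obtain ⟨X, h1, h2, h3⟩ := hF'.exists_edgeBoundary_subset
  rw [Nat.card_eq_fintype_card] at h2
  simp only [Fintype.card_pi, Fintype.card_bool, prod_const, card_univ, Fintype.card_fin] at h2
  exact (two_pow_le_ncard_edgeBoundary hd X (hh.trans h1) (by omega)).1.trans h3

theorem theorem1 (n : ℕ) (hn : 9 ≤ n) :
    -- (a) the concentration of the extra edge-connectivity
    (∀ h : ℕ, (11 * 2 ^ (n - 1)) ⌈/⌉ 48 ≤ h → h ≤ 2 ^ (n - 1) →
      extraEdgeConnectivity (enhancedHypercube n 2) h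
          = minEdgeBoundary (enhancedHypercube n 2) (2 ^ (n - 1)) ∧
        minEdgeBoundary (enhancedHypercube n 2) (2 ^ (n - 1)) = 2 ^ (n - 1)) ∧
    -- (b) optimality holds exactly at the breakpoints, with the common value `2 ^ (n - 1)`
    (∀ h : ℕ, (11 * 2 ^ (n - 1)) ⌈/⌉ 48 ≤ h → h ≤ 2 ^ (n - 1) →
      (IsExtraOptimal (enhancedHypercube n 2) h ↔
        ∃ r : ℕ, 1 ≤ r ∧ r ≤ n ⌈/⌉ 2 - 1 ∧ h = breakpoint n r) ∧
      (IsExtraOptimal (enhancedHypercube n 2) h →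
        minEdgeBoundary (enhancedHypercube n 2) h = 2 ^ (n - 1))) ∧
    -- the breakpoints increase strictly from the left end to the right end of the interval
    (breakpoint n 1 = (11 * 2 ^ (n - 1)) ⌈/⌉ 48 ∧
      breakpoint n (n ⌈/⌉ 2 - 1) = 2 ^ (n - 1) ∧
      ∀ r : ℕ, 1 ≤ r → r < n ⌈/⌉ 2 - 1 → breakpoint n r < breakpoint n (r + 1)) ∧
    -- strictly between consecutive breakpoints the function `ξ` exceeds `2 ^ (n - 1)`
    (∀ r m : ℕ, 1 ≤ r → r < n ⌈/⌉ 2 - 1 → breakpoint n r < m → m < breakpoint n (r + 1) →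
      2 ^ (n - 1) < minEdgeBoundary (enhancedHypercube n 2) m) := by
  obtain ⟨d, rfl⟩ : ∃ d, n = d + 1 := ⟨n - 1, by omega⟩
  have hd : 8 ≤ d := by omega
  have hcd := ceilDiv_two (d + 1)
  simp only [Nat.add_sub_cancel]
  have hconn := fun h => extraEdgeConnectivity_eq_two_pow (d := d) hd h
  have hmin := fun h => two_pow_le_minEdgeBoundary (d := d) hd h
  have hlast := breakpoint_last (d + 1) hn
  have hone := breakpoint_one (d + 1) hn
  rw [Nat.add_sub_cancel] at hlast hone
  have hmono : ∀ r s, 1 ≤ r → r ≤ s → s ≤ (d + 1) ⌈/⌉ 2 - 1 →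
      breakpoint (d + 1) r ≤ breakpoint (d + 1) s := by
    intro r s hr hrs
    induction s, hrs using Nat.le_induction with
    | base => exact fun _ => le_rfl
    | succ s hrs ih =>
      intro hs
      exact (ih (by omega)).trans (breakpoint_lt_succ _ s hn (by omega) (by omega)).le
  refine ⟨fun h hh hh' => ?_, fun h hh hh' => ?_,
    ⟨hone, hlast, fun r => breakpoint_lt_succ _ r hn⟩, fun r m hr hr' hm hm' => ?_⟩
  · have hhalf := (hmin (2 ^ d) (hh.trans hh') le_rfl).2.2
      ⟨(d + 1) ⌈/⌉ 2 - 1, by omega, le_rfl, hlast.symm⟩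
    exact ⟨by rw [hconn h hh hh', hhalf], hhalf⟩
  · rw [IsExtraOptimal, hconn h hh hh', eq_comm]
    exact ⟨(hmin h hh hh').2, id⟩
  · have h1 := hmono 1 r le_rfl hr hr'.le
    have h2 := hmono (r + 1) ((d + 1) ⌈/⌉ 2 - 1) (by omega) (by omega) le_rfl
    obtain ⟨h3, h4⟩ := hmin m (by omega) (by omega)
    refine lt_of_le_of_ne h3 fun he => ?_
    obtain ⟨s, hs, hs', rfl⟩ := h4.1 he.symm
    rcases Nat.lt_or_ge r s with hrs | hrs
    · have := hmono (r + 1) s (by omega) hrs hs'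
      omega
    · have := hmono s r hs hrs hr'.le
      omega
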